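/- Let $(R,\mathfrak m)$ be a Noetherian local ring and let $I\subseteq R$ be an arbitrary ideal ($I=R$ is allowed). Let $\hat R^I=\varprojlim_\alpha R/I^\alpha$ be the $I$-adic completion of $R$, let $H^1_{\mathfrak m}(M)=\varinjlim_\beta \operatorname{Ext}^1_R(R/\mathfrak m^\beta,M)$ denote the first local cohomology module of an $R$-module $M$, and let $T(M)=\varinjlim_\beta \operatorname{Hom}_R(\mathfrak m^\beta,M)$ (transition maps given by restriction), with the canonical homomorphism $M\to T(M)$ which sends $x$ to the class of $r\mapsto rx$. The zero ideal of $\hat R^I$ has a minimal primary decomposition. Let $0=\bigcap_{i=1}^r\mathfrak q_i$ be any minimal primary decomposition of the zero ideal of $\hat R^I$, put $\mathfrak p_i=\operatorname{Rad}\mathfrak q_i$, and let $u(I\hat R^I)$ be the intersection of those $\mathfrak q_i$ for which $\dim \hat R^I/(\mathfrak p_i+I\hat R^I)>0$ (the intersection of the empty family is $\hat R^I$). Then there is a short exact sequence of $R$-modules $$0\to \hat R^I/u(I\hat R^I)\xrightarrow{\ f\ }\varprojlim_\alpha T(R/I^\alpha)\xrightarrow{\ g\ }\varprojlim_\alpha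 H^1_{\mathfrak m}(R/I^\alpha)\to 0,$$ where $f$ is induced by the canonical maps $\hat R^I\to R/I^\alpha\to T(R/I^\alpha)$, and $g$ is the inverse limit of a family of $R$-linear maps $T(R/I^\alpha)\to H^1_{\mathfrak m}(R/I^\alpha)$ compatible with the maps induced by the projections $R/I^\beta\to R/I^\alpha$, $\beta\ge\alpha$. -/

import Mathlib

universe u

noncomputable section

open CategoryTheory IsLocalRing

namespace FormalLC

/-! ### Inverse limits of modules indexed by the natural numbers -/

section InvLim

variable {R : Type*} [CommRing R]

/-- The inverse limit of a system of `R`-modules `M j → M i`, `i ≤ j`: the submodule of the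
product that consists of the compatible families. -/
def invLim {M : ℕ → Type*} [∀ i, AddCommGroup (M i)] [∀ i, Module R (M i)]
    (f : ∀ i j, i ≤ j → M j →ₗ[R] M i) : Submodule R (∀ i, M i) where
  carrier := {x | ∀ i j (h : i ≤ j), f i j h (x j) = x i}
  add_mem' hx hy i j h := by simp [hx i j h, hy i j h]
  zero_mem' i j h := by simp
  smul_mem' c x hx i j h := by simp [hx i j h]

end InvLim

/-! ### The global transform -/

section GlobalTransform

variable {R : Type*} [CommRing R] (m : Ideal R)

/-- The restriction maps `Hom(m ^ i, M) → Hom(m ^ j, M)` for `i ≤ j`. -/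
def restrictPow (M : Type*) [AddCommGroup M] [Module R M] (i j : ℕ) (h : i ≤ j) :
    (↥(m ^ i) →ₗ[R] M) →ₗ[R] (↥(m ^ j) →ₗ[R] M) :=
  LinearMap.lcomp R M (Submodule.inclusion (Ideal.pow_le_pow_right h))

/-- `T(M)`, the direct limit of the modules `Hom(m ^ α, M)`. -/
abbrev GlobalTransform (M : Type*) [AddCommGroup M] [Module R M] : Type _ :=
  Module.DirectLimit (fun α : ℕ => ↥(m ^ α) →ₗ[R] M) (restrictPow m M)

variable {M N : Type*} [AddCommGroup M] [Module R M] [AddCommGroup N] [Module R N]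

/-- Functoriality of `T`: composition with `φ`. -/
def GlobalTransform.map (φ : M →ₗ[R] N) : GlobalTransform m M →ₗ[R] GlobalTransform m N :=
  Module.DirectLimit.map (fun α : ℕ => LinearMap.compRight R φ (M := ↥(m ^ α)))
    (fun _ _ _ => rfl)

/-- The canonical map `M = Hom(m ^ 0, M) → T(M)`; it sends `x` to the class of `r ↦ r • x`. -/
def GlobalTransform.unit (M : Type*) [AddCommGroup M] [Module R M] :
    M →ₗ[R] GlobalTransform m M :=
  Module.DirectLimit.of R ℕ (fun α : ℕ => ↥(m ^ α) →ₗ[R] M) (restrictPow m M) 0 ∘ₗ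
    LinearMap.lcomp R M (m ^ 0).subtype ∘ₗ (LinearMap.lsmul R M).flip

theorem GlobalTransform.map_unit (φ : M →ₗ[R] N) (x : M) :
    GlobalTransform.map m φ (GlobalTransform.unit m M x) = GlobalTransform.unit m N (φ x) := by
  refine (Module.DirectLimit.map_apply_of _ _ _).trans ?_
  refine congrArg (Module.DirectLimit.of R ℕ (fun α : ℕ => ↥(m ^ α) →ₗ[R] N)
    (restrictPow m N) 0) ?_
  ext r
  simp

end GlobalTransform

/-! ### The two inverse systems attached to the powers of an ideal -/

section Systems

variable {R : Type u} [CommRing R]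

/-- The projection `R ⧸ I ^ j → R ⧸ I ^ i` for `i ≤ j`. -/
def proj (I : Ideal R) (i j : ℕ) (h : i ≤ j) : (R ⧸ I ^ j) →ₗ[R] (R ⧸ I ^ i) :=
  (Ideal.Quotient.factorₐ R (Ideal.pow_le_pow_right h)).toLinearMap

variable [IsLocalRing R]

/-- The inverse limit of the modules `T(R ⧸ I ^ α)`. -/
abbrev limT (I : Ideal R) :
    Submodule R (∀ α : ℕ, GlobalTransform (maximalIdeal R) (R ⧸ I ^ α)) :=
  invLim (fun i j h => GlobalTransform.map (maximalIdeal R) (proj I i j h))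

/-- The local cohomology module `H^i` of `R ⧸ I ^ α` with support in the maximal ideal. -/
abbrev H (i : ℕ) (I : Ideal R) (α : ℕ) : Type u :=
  (localCohomology (maximalIdeal R) i).obj (ModuleCat.of R (R ⧸ I ^ α))

/-- The maps between the modules `H i I α` that are induced by the projections. -/
def transH (n : ℕ) (I : Ideal R) (i j : ℕ) (h : i ≤ j) : H n I j →ₗ[R] H n I i :=
  ((localCohomology (maximalIdeal R) n).map (ModuleCat.ofHom (proj I i j h))).hom

/-- The formal local cohomology module, the inverse limit of the `H^i` of `R ⧸ I ^ α`. -/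
abbrev limH (i : ℕ) (I : Ideal R) : Submodule R (∀ α : ℕ, H i I α) :=
  invLim (transH i I)

/-- The canonical map from the `I`-adic completion of `R` to the inverse limit of the modules
`T(R ⧸ I ^ α)`, induced by the canonical maps `R ⧸ I ^ α → T(R ⧸ I ^ α)`. -/
def completionToLimT (I : Ideal R) : AdicCompletion I R →ₗ[R] limT I :=
  LinearMap.codRestrict (limT I)
    (LinearMap.pi fun α =>
      GlobalTransform.unit (maximalIdeal R) (R ⧸ I ^ α) ∘ₗ (AdicCompletion.evalₐ I α).toLinearMap)
    (by
      intro x i j h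
      simp only [LinearMap.pi_apply, LinearMap.comp_apply, GlobalTransform.map_unit]
      congr 1
      induction x using AdicCompletion.induction_on with
      | h a =>
        simp only [AlgHom.toLinearMap_apply, AdicCompletion.evalₐ_mk]
        exact AdicCompletion.Ideal.mk_eq_mk I h a)

end Systems

/-! ### The ideal `u(J)` -/

/-- For a minimal primary decomposition of the zero ideal of `S` with the set `t` of primary
components, the intersection of those `q` in `t` with `dim S / (rad q + J) > 0`.  (The Krull
dimension of the zero ring is `⊥`; the intersection of no ideals is `S`.) -/
def uIdeal {S : Type*} [CommRing S] (t : Finset (Ideal S)) (J : Ideal S) : Ideal S :=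
  sInf {q | q ∈ t ∧ 0 < ringKrullDim (S ⧸ (q.radical ⊔ J))}

end FormalLC

end

noncomputable section

open CategoryTheory IsLocalRing

namespace FormalLC

/-! Applying `Hom(-, M)` to `0 → m ^ β → R → R ⧸ m ^ β → 0` and passing to the colimit over `β`
gives an exact sequence `M → T(M) → H¹(M) → 0`, natural in `M`; the kernel of `M → T(M)` is the
`m`-power torsion. It remains to take `M = R ⧸ I ^ α` and pass to the limit over `α`.

Surjectivity survives because the projections `R ⧸ I ^ (α + 1) → R ⧸ I ^ α` are surjective
(`limConnecting_surjective`). Exactness in the middle survives because the torsion kernels have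
finite length, so a Mittag-Leffler argument applies (`exists_compatible_sequence_of_isArtinian`).

The kernel of the map out of the completion consists of the elements that are `m`-power torsion
modulo every power of the extended ideal `J` of `I`. By `mem_uIdeal_iff` this is `u(J)`: primes
containing `J` are maximal exactly when they contain the image of `m`, the components of dimension
at most zero account for the torsion, and Krull's intersection theorem at a nonmaximal prime puts
torsion elements into the remaining components. This needs the completion to be Noetherian, which
also provides the primary decompositions. -/

/-! ### Noetherianity of the adic completion -/

theorem isNoetherianRing_adicCompletion_idealOfVars (σ R : Type*) [Finite σ] [CommRing R]
    [IsNoetherianRing R] :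
    IsNoetherianRing (AdicCompletion (MvPolynomial.idealOfVars σ R) (MvPolynomial σ R)) :=
  isNoetherianRing_of_ringEquiv (MvPowerSeries σ R)
    (MvPowerSeries.toAdicCompletionAlgEquiv σ R).toRingEquiv

/-- For finitely generated `I` the extended ideal is the kernel of `evalOneₐ`, so every class has a
representative in `R`. -/
theorem surjective_mk_comp_algebraMap {R : Type*} [CommRing R] {I : Ideal R} (hI : I.FG) :
    Function.Surjective ((Ideal.Quotient.mk (I.map (algebraMap R (AdicCompletion I R)))).comp
      (algebraMap R (AdicCompletion I R))) := by
  intro y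
  obtain ⟨x, rfl⟩ := Ideal.Quotient.mk_surjective y
  obtain ⟨r, hr⟩ := Ideal.Quotient.mk_surjective (AdicCompletion.evalOneₐ I x)
  refine ⟨r, ?_⟩
  rw [RingHom.comp_apply, Ideal.Quotient.eq, ← AdicCompletion.ker_evalOneₐ_eq_map I hI]
  change AdicCompletion.evalOneₐ I _ = 0
  rw [map_sub, AlgHom.commutes, ← hr, sub_eq_zero]
  rfl

/-- A surjection of rings induces a surjection of the adic completions, so that the completion
of the target is Noetherian if that of the source is. -/
theorem isNoetherianRing_adicCompletion_of_surjective {A R : Type*} [CommRing A] [CommRing R]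
    (e : A →+* R) (he : Function.Surjective e) {J : Ideal A} (hJ : J.FG) {I : Ideal R}
    (hJI : J.map e = I) [IsNoetherianRing (AdicCompletion J A)] :
    IsNoetherianRing (AdicCompletion I R) := by
  have hI : I.FG := hJI ▸ hJ.map e
  have hpow (n : ℕ) : J ^ n ≤ (I ^ n).comap e := by
    rw [← Ideal.map_le_iff_le_comap, Ideal.map_pow, hJI]
  let f (n : ℕ) : AdicCompletion J A →+* R ⧸ I ^ n :=
    (Ideal.quotientMap (I ^ n) e (hpow n)).comp (AdicCompletion.evalₐ J n).toRingHom
  have hfn (n : ℕ) (x : AdicCompletion J A) :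
      f n x = Ideal.quotientMap (I ^ n) e (hpow n) (AdicCompletion.evalₐ J n x) := rfl
  have hf {m n : ℕ} (h : m ≤ n) : (Ideal.Quotient.factorPow I h).comp (f n) = f m := by
    refine RingHom.ext fun x => ?_
    induction x using AdicCompletion.induction_on with
    | h a =>
      have h1 : f n (AdicCompletion.mk J A a) = Ideal.Quotient.mk (I ^ n) (e (a n)) := by
        rw [hfn, AdicCompletion.evalₐ_mk, Ideal.quotientMap_mk]
      have h2 : f m (AdicCompletion.mk J A a) = Ideal.Quotient.mk (I ^ m) (e (a n)) := by
        rw [hfn, AdicCompletion.evalₐ_mk, ← AdicCompletion.Ideal.mk_eq_mk J h a, Ideal.quotientMap_mk]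
      rw [RingHom.comp_apply, h1, h2]
      rfl
  let F := AdicCompletion.liftRingHom I f hf
  have hFe (a : A) : F (algebraMap A _ a) = algebraMap R _ (e a) := by
    apply AdicCompletion.ext_evalₐ
    intro n
    rw [AdicCompletion.evalₐ_liftRingHom, AlgHom.commutes, hfn, AlgHom.commutes]
    exact Ideal.quotientMap_mk
  have := AdicCompletion.isAdicComplete_self I hI
  have := AdicCompletion.isAdicComplete_self J hJ
  have hmap : (J.map (algebraMap A (AdicCompletion J A))).map F =
      I.map (algebraMap R (AdicCompletion I R)) := by
    have h := congrArg (Ideal.map (algebraMap R (AdicCompletion I R))) hJI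
    rw [Ideal.map_map] at h ⊢
    rw [← h]
    exact congrArg (fun g => Ideal.map g J) (RingHom.ext hFe)
  have hh : IsHausdorff ((J.map (algebraMap A (AdicCompletion J A))).map F)
      (AdicCompletion I R) := by
    rw [hmap]; infer_instance
  -- The source is complete and the target Hausdorff, so surjectivity of `F` need only be checked
  -- modulo the extended ideals, where every class comes from `A`.
  refine isNoetherianRing_of_surjective _ _ F
    (surjective_of_mk_map_comp_surjective (I := J.map (algebraMap A (AdicCompletion J A))) F ?_)
  rw [hmap]
  intro y
  obtain ⟨r, rfl⟩ := surjective_mk_comp_algebraMap hI y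
  obtain ⟨a, rfl⟩ := he r
  refine ⟨algebraMap A _ a, ?_⟩
  rw [RingHom.comp_apply, hFe]
  rfl

/-- The adic completion of a Noetherian ring is Noetherian. -/
theorem isNoetherianRing_adicCompletion {R : Type*} [CommRing R] [IsNoetherianRing R]
    (I : Ideal R) : IsNoetherianRing (AdicCompletion I R) := by
  obtain ⟨s, hs⟩ := (isNoetherianRing_iff_ideal_fg R).1 inferInstance I
  -- One variable for each generator of `I`; evaluation carries the ideal of the variables to `I`.
  have := isNoetherianRing_adicCompletion_idealOfVars s R
  refine isNoetherianRing_adicCompletion_of_surjective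
    (MvPolynomial.eval (fun i : s => (i : R))) (fun r => ⟨MvPolynomial.C r, by simp⟩)
    (MvPolynomial.idealOfVars_fg s R) ?_
  rw [← hs, MvPolynomial.idealOfVars, Ideal.map_span, ← Set.range_comp]
  congr 1
  ext x
  simp

/-! ### The ideal `u(J)` as a torsion ideal -/

theorem krullDim_quotient_pos_iff {S : Type*} [CommRing S] (a : Ideal S) :
    0 < ringKrullDim (S ⧸ a) ↔ ∃ P : Ideal S, P.IsPrime ∧ a ≤ P ∧ ¬ P.IsMaximal := by
  rw [← not_le]
  have h0 : ringKrullDim (S ⧸ a) ≤ 0 ↔ Ring.KrullDimLE 0 (S ⧸ a) := by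
    rw [Ring.krullDimLE_iff]; rfl
  rw [h0, Ring.krullDimLE_zero_iff, not_forall]
  constructor
  · rintro ⟨Q, hQ⟩
    rw [Classical.not_imp] at hQ
    obtain ⟨hQp, hQm⟩ := hQ
    refine ⟨Q.comap (Ideal.Quotient.mk a), inferInstance, ?_, fun h => hQm ?_⟩
    · conv_lhs => rw [← Ideal.mk_ker (I := a)]
      exact Ideal.comap_mono bot_le
    · rcases Ideal.map_eq_top_or_isMaximal_of_surjective (Ideal.Quotient.mk a)
        Ideal.Quotient.mk_surjective h with h' | h'
      · rw [Ideal.map_comap_of_surjective _ Ideal.Quotient.mk_surjective] at h'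
        exact absurd h' hQp.ne_top
      · rwa [Ideal.map_comap_of_surjective _ Ideal.Quotient.mk_surjective] at h'
  · rintro ⟨P, hP, haP, hPm⟩
    refine ⟨P.map (Ideal.Quotient.mk a), fun h => hPm ?_⟩
    have := h (Ideal.map_isPrime_of_surjective Ideal.Quotient.mk_surjective (by simpa using haP))
    have h2 := Ideal.comap_isMaximal_of_surjective (Ideal.Quotient.mk a)
      Ideal.Quotient.mk_surjective (K := P.map (Ideal.Quotient.mk a))
    rwa [Ideal.comap_map_of_surjective _ Ideal.Quotient.mk_surjective, ← RingHom.ker_eq_comap_bot,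
      Ideal.mk_ker, sup_eq_left.2 haP] at h2

section

variable {R S : Type*} [CommRing R] [CommRing S] (φ : R →+* S) {J : Ideal S}
  (hφ : Function.Surjective ((Ideal.Quotient.mk J).comp φ))

include hφ in
theorem surjective_mk_comp_of_le {P : Ideal S} (h : J ≤ P) :
    Function.Surjective ((Ideal.Quotient.mk P).comp φ) := by
  intro y
  obtain ⟨x, rfl⟩ := Ideal.Quotient.mk_surjective y
  obtain ⟨r, hr⟩ := hφ (Ideal.Quotient.mk J x)
  refine ⟨r, ?_⟩
  rw [RingHom.comp_apply, Ideal.Quotient.eq] at hr ⊢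
  exact h hr

variable [IsLocalRing R]

include hφ in
-- `S ⧸ P` is the quotient of `R` by the contraction of `P`, hence a field exactly when that
-- contraction is the maximal ideal.
theorem isMaximal_iff_map_maximalIdeal_le {P : Ideal S} [hP : P.IsPrime] (h : J ≤ P) :
    P.IsMaximal ↔ (maximalIdeal R).map φ ≤ P := by
  have hs := surjective_mk_comp_of_le φ hφ h
  have hker : RingHom.ker ((Ideal.Quotient.mk P).comp φ) = P.comap φ := by
    ext r; simp [RingHom.mem_ker, Ideal.Quotient.eq_zero_iff_mem]
  constructor
  · intro hm
    let := Ideal.Quotient.field P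
    have : (RingHom.ker ((Ideal.Quotient.mk P).comp φ)).IsMaximal :=
      RingHom.ker_isMaximal_of_surjective _ hs
    rw [Ideal.map_le_iff_le_comap, ← hker, IsLocalRing.eq_maximalIdeal this]
  · intro hm
    rw [Ideal.map_le_iff_le_comap, ← hker] at hm
    have hne : RingHom.ker ((Ideal.Quotient.mk P).comp φ) ≠ ⊤ := RingHom.ker_ne_top _
    have heq := (IsLocalRing.maximalIdeal.isMaximal R).eq_of_le hne hm
    have : (RingHom.ker ((Ideal.Quotient.mk P).comp φ)).IsMaximal := by
      rw [← heq]; infer_instance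
    have hf := (Ideal.Quotient.maximal_ideal_iff_isField_quotient _).1 this
    exact Ideal.Quotient.maximal_of_isField _
      ((RingHom.quotientKerEquivOfSurjective hs).toMulEquiv.symm.isField hf)

include hφ in
/-- The intersection of the primary components of positive dimension consists of the elements
that are torsion modulo all powers of `J`. -/
theorem mem_uIdeal_iff [IsNoetherianRing S] {t : Finset (Ideal S)}
    (ht : Submodule.IsMinimalPrimaryDecomposition (⊥ : Ideal S) t) (x : S) :
    x ∈ uIdeal t J ↔ ∀ α : ℕ, ∃ β : ℕ, ∀ r ∈ maximalIdeal R ^ β, φ r * x ∈ J ^ α := by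
  classical
  constructor
  · intro hx α
    -- The intersection of the complementary components: its elements kill `x`, since the product
    -- lies in every component.
    let v : Ideal S := (t.filter fun q => ¬ 0 < ringKrullDim (S ⧸ (q.radical ⊔ J))).inf id
    have hvx : ∀ y ∈ v, y * x = 0 := by
      intro y hy
      have : y * x ∈ t.inf id := by
        rw [Submodule.mem_finsetInf]
        intro q hq
        by_cases h : 0 < ringKrullDim (S ⧸ (q.radical ⊔ J))
        · exact Ideal.mul_mem_left q _ ((Submodule.mem_sInf.1 hx) q ⟨hq, h⟩)
        · exact Ideal.mul_mem_right _ q ((Submodule.mem_finsetInf.1 hy) q (Finset.mem_filter.2 ⟨hq, h⟩))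
      rw [ht.inf_eq] at this
      simpa using this
    -- A prime over `v ⊔ J ^ α` contains `J` and one of the components of `v`, so it is maximal and
    -- contains the image of the maximal ideal.
    have hle : (maximalIdeal R).map φ ≤ (v ⊔ J ^ α).radical := by
      rw [Ideal.radical_eq_sInf]
      refine le_sInf ?_
      rintro P ⟨hP, hPp⟩
      rcases Nat.eq_zero_or_pos α with rfl | hα
      · exact absurd (by simpa using hP) hPp.ne_top
      have hJP : J ≤ P := hPp.le_of_pow_le (le_sup_right.trans hP)
      have hvP : v ≤ P := le_sup_left.trans hP
      obtain ⟨q, hq, hqP⟩ := (hPp.inf_le').1 hvP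
      simp only [Finset.mem_filter, id] at hq hqP
      rw [← isMaximal_iff_map_maximalIdeal_le φ hφ hJP]
      by_contra hPm
      exact hq.2 ((krullDim_quotient_pos_iff _).2
        ⟨P, hPp, sup_le (hPp.radical_le_iff.2 hqP) hJP, hPm⟩)
    obtain ⟨β, hβ⟩ := Ideal.exists_radical_pow_le_of_fg (v ⊔ J ^ α)
      ((isNoetherianRing_iff_ideal_fg S).1 inferInstance _)
    refine ⟨β, fun r hr => ?_⟩
    have : φ r ∈ v ⊔ J ^ α := by
      apply hβ
      apply Ideal.pow_right_mono hle β
      rw [← Ideal.map_pow]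
      exact Ideal.mem_map_of_mem φ hr
    obtain ⟨y, hy, z, hz, hyz⟩ := Submodule.mem_sup.1 this
    rw [← hyz, add_mul, hvx y hy, zero_add]
    exact Ideal.mul_mem_right _ _ hz
  · intro hx
    refine Submodule.mem_sInf.2 ?_
    rintro q ⟨hq, hdim⟩
    obtain ⟨P, hPp, hle, hPm⟩ := (krullDim_quotient_pos_iff _).1 hdim
    have hJP : J ≤ P := le_sup_right.trans hle
    rw [isMaximal_iff_map_maximalIdeal_le φ hφ hJP, Ideal.map_le_iff_le_comap,
      SetLike.not_le_iff_exists] at hPm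
    obtain ⟨a, ham, haP⟩ := hPm
    -- In `L` the powers of `φ a` are units, so the torsion condition puts `x` into all powers of
    -- the extension of `J`, and Krull's theorem makes its image zero.
    let L := Localization.AtPrime P
    have hxL : algebraMap S L x ∈ (⨅ α : ℕ, (J.map (algebraMap S L)) ^ α) := by
      refine Submodule.mem_iInf _ |>.2 fun α => ?_
      obtain ⟨β, hβ⟩ := hx α
      have h1 := Ideal.mem_map_of_mem (algebraMap S L) (hβ (a ^ β) (Ideal.pow_mem_pow ham β))
      rw [map_mul, Ideal.map_pow] at h1
      have hu : IsUnit (algebraMap S L (φ (a ^ β))) := by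
        refine IsLocalization.map_units L (⟨φ (a ^ β), ?_⟩ : P.primeCompl)
        rw [map_pow]
        exact fun h => haP (hPp.mem_of_pow_mem _ h)
      exact (Ideal.unit_mul_mem_iff_mem _ hu).1 h1
    have hJL : J.map (algebraMap S L) ≠ ⊤ := by
      intro h
      have : J.map (algebraMap S L) ≤ maximalIdeal L := by
        rw [← Localization.AtPrime.map_eq_maximalIdeal]
        exact Ideal.map_mono hJP
      rw [h] at this
      exact (Ideal.IsPrime.ne_top inferInstance) (top_le_iff.1 this)
    have : IsNoetherianRing L := IsLocalization.isNoetherianRing P.primeCompl L inferInstance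
    rw [Ideal.iInf_pow_eq_bot_of_isLocalRing _ hJL, Ideal.mem_bot,
      IsLocalization.map_eq_zero_iff P.primeCompl] at hxL
    obtain ⟨s, hs⟩ := hxL
    have hprim := ht.primary hq
    have hsx : (s : S) * x ∈ q := by rw [hs]; exact q.zero_mem
    -- The element `s` lies outside `P`, hence outside the radical of `q`.
    rcases (Ideal.isPrimary_iff.1 hprim).2 (by rwa [mul_comm] at hsx) with h | h
    · exact h
    · exact absurd (hle (Ideal.mem_sup_left h)) s.2

end

open Limits Opposite

/-! ### Comparing a short exact sequence with a presentation -/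

section LinearAlgebra

variable {R X₁ X₀ K P A M : Type*} [CommRing R] [AddCommGroup X₁] [Module R X₁]
  [AddCommGroup X₀] [Module R X₀] [AddCommGroup K] [Module R K] [AddCommGroup P] [Module R P]
  [AddCommGroup A] [Module R A] [AddCommGroup M] [Module R M]
  {d : X₁ →ₗ[R] X₀} {π : X₀ →ₗ[R] A} {i : K →ₗ[R] P} {q : P →ₗ[R] A} {f : X₀ →ₗ[R] P}
  {l : X₁ →ₗ[R] K} {g : P →ₗ[R] X₀}

/-- For `0 → K → P → A → 0` and a presentation `X₁ → X₀ → A` with comparison maps, a map on `K`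
whose restriction to `X₁` extends to `X₀` extends to `P`. -/
theorem exists_extension (hdπ : Function.Exact d π) (hi : Function.Injective i)
    (hiq : Function.Exact i q) (hf : q ∘ₗ f = π) (hg : π ∘ₗ g = q) (hl : i ∘ₗ l = f ∘ₗ d)
    (κ : K →ₗ[R] M) (ψ : X₀ →ₗ[R] M) (h : κ ∘ₗ l = ψ ∘ₗ d) : ∃ ε : P →ₗ[R] M, ε ∘ₗ i = κ := by
  have hr (p : P) : p - f (g p) ∈ LinearMap.range i := by
    rw [LinearMap.mem_range]
    refine (hiq _).1 ?_
    have h1 : q (f (g p)) = π (g p) := LinearMap.congr_fun hf (g p)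
    have h2 : π (g p) = q p := LinearMap.congr_fun hg p
    rw [map_sub, h1, h2, sub_self]
  let e := LinearEquiv.ofInjective i hi
  let r : P →ₗ[R] K := e.symm.toLinearMap ∘ₗ
    LinearMap.codRestrict (LinearMap.range i) (LinearMap.id - f ∘ₗ g) hr
  have hir (p : P) : i (r p) = p - f (g p) := by
    have := LinearEquiv.apply_symm_apply e (LinearMap.codRestrict (LinearMap.range i)
      (LinearMap.id - f ∘ₗ g) hr p)
    exact congrArg Subtype.val this
  -- On `k`, with `g (i k) = d x`, the retraction `r` yields `k - l x`; the defect `κ (l x)` is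
  -- restored by `ψ (d x)`.
  refine ⟨κ ∘ₗ r + ψ ∘ₗ g, LinearMap.ext fun k => ?_⟩
  obtain ⟨x, hx⟩ := (hdπ (g (i k))).1 (by
    rw [← LinearMap.comp_apply π, hg]; exact hiq.apply_apply_eq_zero k)
  have hk : r (i k) = k - l x := by
    apply hi
    rw [hir, map_sub, ← hx, ← LinearMap.comp_apply i, hl]
    rfl
  have h' : κ (l x) = ψ (d x) := LinearMap.congr_fun h x
  simp only [LinearMap.comp_apply, LinearMap.add_apply, hk, map_sub, ← hx, h']
  abel

/-- A cocycle on `X₁` is, up to a coboundary, induced by a map on `K`. -/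
theorem exists_cocycle_comparison (hdπ : Function.Exact d π)
    (hiq : Function.Exact i q) (hf : q ∘ₗ f = π) (hg : π ∘ₗ g = q) (hl : i ∘ₗ l = f ∘ₗ d)
    (φ : X₁ →ₗ[R] M) (hφ : ∀ x, d x = 0 → φ x = 0) :
    ∃ (κ : K →ₗ[R] M) (ψ : X₀ →ₗ[R] M), φ - κ ∘ₗ l = ψ ∘ₗ d := by
  let Z := LinearMap.range d
  have hZ (x : X₀) : π x = 0 → x ∈ Z := fun h => LinearMap.mem_range.2 ((hdπ x).1 h)
  let φ' : Z →ₗ[R] M := (LinearMap.ker d).liftQ φ (fun x hx => hφ x hx) ∘ₗ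
    d.quotKerEquivRange.symm.toLinearMap
  have hφ' (x : X₁) (h : d x ∈ Z) : φ' ⟨d x, h⟩ = φ x := by
    have : (⟨d x, h⟩ : Z) = d.quotKerEquivRange ((LinearMap.ker d).mkQ x) := rfl
    rw [this, LinearMap.comp_apply, LinearEquiv.coe_coe, LinearEquiv.symm_apply_apply]
    rfl
  have h1 (k : K) : g (i k) ∈ Z := hZ _ (by
    rw [← LinearMap.comp_apply π, hg]; exact hiq.apply_apply_eq_zero k)
  have h2 (x : X₀) : x - g (f x) ∈ Z := hZ _ (by
    rw [map_sub, ← LinearMap.comp_apply π g, hg, ← LinearMap.comp_apply q, hf, sub_self])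
  -- Split `d x` as `g (f (d x))`, which equals `g (i (l x))`, plus `d x - g (f (d x))`; both parts
  -- lie in the range of `d`, where `φ` descends to `φ'`.
  refine ⟨φ' ∘ₗ LinearMap.codRestrict Z (g ∘ₗ i) h1,
    φ' ∘ₗ LinearMap.codRestrict Z (LinearMap.id - g ∘ₗ f) h2, LinearMap.ext fun x => ?_⟩
  have h3 : i (l x) = f (d x) := LinearMap.congr_fun hl x
  simp only [LinearMap.sub_apply, LinearMap.comp_apply]
  rw [← hφ' x ⟨x, rfl⟩, ← map_sub]
  congr 1
  ext
  simp [h3]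

end LinearAlgebra

/-! ### The connecting morphism of a left derived functor -/

section Connecting

variable {C : Type*} [Category C] [Abelian C] {D : Type*} [Category D]
  [Abelian D]

variable {S : ShortComplex C} (hS : S.ShortExact) (P : ProjectiveResolution S.X₃)

/-- The augmentation of a projective resolution, as a map from its term in degree zero. -/
def augmentation {Z : C} (P : ProjectiveResolution Z) : P.complex.X 0 ⟶ Z := P.π.f 0

theorem d_comp_augmentation {Z : C} (P : ProjectiveResolution Z) :
    P.complex.d 1 0 ≫ augmentation P = 0 := P.complex_d_comp_π_f_zero

/-- A lift of the augmentation of a projective resolution along an epimorphism. -/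
def liftZero : P.complex.X 0 ⟶ S.X₂ :=
  have : Epi S.g := hS.epi_g
  Projective.factorThru (augmentation P) S.g

theorem liftZero_comp : liftZero hS P ≫ S.g = augmentation P := by
  have : Epi S.g := hS.epi_g
  exact Projective.factorThru_comp _ _

/-- The map from degree one of a projective resolution to the kernel. -/
def liftOne : P.complex.X 1 ⟶ S.X₁ :=
  have := hS.mono_f
  hS.exact.lift (P.complex.d 1 0 ≫ liftZero hS P) (by
    rw [Category.assoc, liftZero_comp, d_comp_augmentation])

theorem liftOne_comp : liftOne hS P ≫ S.f = P.complex.d 1 0 ≫ liftZero hS P := by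
  have := hS.mono_f
  exact hS.exact.lift_f _ _

theorem d_comp_liftOne : P.complex.d 2 1 ≫ liftOne hS P = 0 := by
  have := hS.mono_f
  rw [← cancel_mono S.f, Category.assoc, liftOne_comp, ← Category.assoc,
    HomologicalComplex.d_comp_d, zero_comp, zero_comp]

/-- The lifts to `S'.X₂` through `φ` and through `τ` agree after `S'.g`, so their difference factors
through the kernel; this is the homotopy `h`. -/
theorem liftOne_naturality {S' : ShortComplex C} (hS' : S'.ShortExact) (τ : S ⟶ S')
    (P' : ProjectiveResolution S'.X₃) (φ : P.complex ⟶ P'.complex)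
    (comm : φ.f 0 ≫ augmentation P' = augmentation P ≫ τ.τ₃) :
    ∃ h : P.complex.X 0 ⟶ S'.X₁,
      φ.f 1 ≫ liftOne hS' P' - liftOne hS P ≫ τ.τ₁ = P.complex.d 1 0 ≫ h := by
  have := hS'.mono_f
  refine ⟨hS'.exact.lift (φ.f 0 ≫ liftZero hS' P' - liftZero hS P ≫ τ.τ₂) ?_, ?_⟩
  · rw [Preadditive.sub_comp, Category.assoc, Category.assoc, liftZero_comp, comm, τ.comm₂₃,
      ← Category.assoc, liftZero_comp, sub_self]
  · rw [← cancel_mono S'.f, Preadditive.sub_comp, Category.assoc, Category.assoc, Category.assoc,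
      liftOne_comp, τ.comm₁₂, ← Category.assoc _ S.f, liftOne_comp, hS'.exact.lift_f,
      Preadditive.comp_sub, φ.comm_assoc, Category.assoc]

variable (F : C ⥤ D) [F.Additive]

/-- The value of an additive functor on the complex of a projective resolution. -/
abbrev mapComplex {Z : C} (P : ProjectiveResolution Z) : ChainComplex D ℕ :=
  (F.mapHomologicalComplex (ComplexShape.down ℕ)).obj P.complex

/-- The connecting morphism on opcycles. -/
def opcyclesToObj : (mapComplex F P).opcycles 1 ⟶ F.obj S.X₁ :=
  HomologicalComplex.descOpcycles _ (F.map (liftOne hS P)) 2 (by simp) (by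
    change F.map _ ≫ F.map _ = 0
    rw [← F.map_comp, d_comp_liftOne, F.map_zero])

theorem pOpcycles_opcyclesToObj :
    (mapComplex F P).pOpcycles 1 ≫ opcyclesToObj hS P F = F.map (liftOne hS P) :=
  HomologicalComplex.p_descOpcycles _ _ _ _ _

/-- The difference factors through `fromOpcycles`, which vanishes on homology. -/
theorem homologyι_comp_eq {K : ChainComplex D ℕ} {Y : D} (a b : K.opcycles 1 ⟶ Y)
    (h : K.X 0 ⟶ Y) (hab : K.pOpcycles 1 ≫ (a - b) = K.d 1 0 ≫ h) :
    K.homologyι 1 ≫ a = K.homologyι 1 ≫ b := by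
  rw [← sub_eq_zero, ← Preadditive.comp_sub]
  have : a - b = K.fromOpcycles 1 0 ≫ h := by
    rw [← cancel_epi (K.pOpcycles 1), hab, HomologicalComplex.p_fromOpcycles_assoc]
  rw [this, HomologicalComplex.homologyι_comp_fromOpcycles_assoc, zero_comp]

theorem homologyι_opcyclesToObj_naturality {S' : ShortComplex C} (hS' : S'.ShortExact) (τ : S ⟶ S')
    (P' : ProjectiveResolution S'.X₃) (φ : P.complex ⟶ P'.complex)
    (comm : φ.f 0 ≫ augmentation P' = augmentation P ≫ τ.τ₃) :
    HomologicalComplex.homologyMap ((F.mapHomologicalComplex _).map φ) 1 ≫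
      (mapComplex F P').homologyι 1 ≫ opcyclesToObj hS' P' F =
    (mapComplex F P).homologyι 1 ≫ opcyclesToObj hS P F ≫ F.map τ.τ₁ := by
  obtain ⟨h, hh⟩ := liftOne_naturality hS P hS' τ P' φ comm
  rw [HomologicalComplex.homologyι_naturality_assoc]
  refine homologyι_comp_eq _ _ (F.map h) ?_
  rw [Preadditive.comp_sub, HomologicalComplex.p_opcyclesMap_assoc, pOpcycles_opcyclesToObj,
    ← Category.assoc _ _ (F.map τ.τ₁), pOpcycles_opcyclesToObj]
  change F.map _ ≫ F.map _ - F.map _ ≫ F.map _ = F.map _ ≫ F.map _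
  rw [← F.map_comp, ← F.map_comp, ← F.map_comp, ← hh, F.map_sub]
  rfl

theorem homologyι_opcyclesToObj_naturality_functor {F G : C ⥤ D} [F.Additive] [G.Additive]
    (α : F ⟶ G) :
    HomologicalComplex.homologyMap
        ((NatTrans.mapHomologicalComplex α (ComplexShape.down ℕ)).app P.complex) 1 ≫
      (mapComplex G P).homologyι 1 ≫ opcyclesToObj hS P G =
    (mapComplex F P).homologyι 1 ≫ opcyclesToObj hS P F ≫ α.app S.X₁ := by
  have h := HomologicalComplex.homologyι_naturality
    ((NatTrans.mapHomologicalComplex α (ComplexShape.down ℕ)).app P.complex) 1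
  refine (Category.assoc _ _ _).symm.trans ((congrArg (· ≫ opcyclesToObj hS P G) h).trans
    ((Category.assoc _ _ _).trans (congrArg ((mapComplex F P).homologyι 1 ≫ ·) ?_)))
  refine (cancel_epi ((mapComplex F P).pOpcycles 1)).1 ?_
  have h2 := HomologicalComplex.p_opcyclesMap
    ((NatTrans.mapHomologicalComplex α (ComplexShape.down ℕ)).app P.complex) 1
  refine (Category.assoc _ _ _).symm.trans ((congrArg (· ≫ opcyclesToObj hS P G) h2).trans
    ((Category.assoc _ _ _).trans ?_))
  rw [← Category.assoc _ _ (α.app S.X₁), pOpcycles_opcyclesToObj]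
  exact (α.naturality _).symm.trans (congrArg (· ≫ α.app S.X₁) (pOpcycles_opcyclesToObj hS P F).symm)

variable [EnoughProjectives C]

/-- The connecting morphism `L₁F(A) ⟶ F(K)` of a short exact sequence `0 → K → P → A → 0`. -/
def connecting : (F.leftDerived 1).obj S.X₃ ⟶ F.obj S.X₁ :=
  (P.isoLeftDerivedObj F 1).hom ≫ (mapComplex F P).homologyι 1 ≫ opcyclesToObj hS P F

theorem connecting_naturality {S' : ShortComplex C} (hS' : S'.ShortExact) (τ : S ⟶ S')
    (P' : ProjectiveResolution S'.X₃) :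
    (F.leftDerived 1).map τ.τ₃ ≫ connecting hS' P' F = connecting hS P F ≫ F.map τ.τ₁ := by
  let φ := ProjectiveResolution.lift τ.τ₃ P P'
  have comm : φ.f 0 ≫ augmentation P' = augmentation P ≫ τ.τ₃ :=
    ProjectiveResolution.lift_commutes_zero _ _ _
  rw [connecting, connecting, ProjectiveResolution.isoLeftDerivedObj_hom_naturality_assoc
    τ.τ₃ P P' φ comm F, Category.assoc]
  refine congrArg (fun x => (P.isoLeftDerivedObj F 1).hom ≫ x) ?_
  exact (homologyι_opcyclesToObj_naturality hS P F hS' τ P' φ comm).trans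
    (Category.assoc _ _ _).symm

theorem connecting_naturality_functor {F G : C ⥤ D} [F.Additive] [G.Additive] (α : F ⟶ G) :
    (NatTrans.leftDerived α 1).app S.X₃ ≫ connecting hS P G = connecting hS P F ≫ α.app S.X₁ := by
  rw [connecting, connecting, ProjectiveResolution.leftDerived_app_eq α P]
  simp only [Category.assoc, Iso.inv_hom_id_assoc]
  exact congrArg (fun x => (P.isoLeftDerivedObj F 1).hom ≫ x)
    ((homologyι_opcyclesToObj_naturality_functor hS P α).trans (Category.assoc _ _ _).symm)

end Connecting

/-! ### The connecting map into `Ext¹` -/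

section OppositeHomology

variable {R : Type u} [CommRing R] (K : ChainComplex (ModuleCat.{u} R)ᵒᵖ ℕ)

/-- After `unop`, opcycles are cocycles, `pOpcycles` is their inclusion into the cochains and
`homologyι` their projection onto cohomology. -/
theorem homologyι_unop_surjective : Function.Surjective (K.homologyι 1).unop.hom :=
  (ModuleCat.epi_iff_surjective _).1 inferInstance

theorem pOpcycles_unop_injective : Function.Injective (K.pOpcycles 1).unop.hom :=
  (ModuleCat.mono_iff_injective _).1 inferInstance

theorem exists_of_homologyι_unop_eq_zero (z : (K.opcycles 1).unop)
    (hz : (K.homologyι 1).unop.hom z = 0) : ∃ ψ, (K.fromOpcycles 1 0).unop.hom ψ = z := by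
  have h := (ShortComplex.exact_of_f_is_kernel
    (ShortComplex.mk _ _ (K.homologyι_comp_fromOpcycles 1 0))
    (K.homologyIsKernel 1 0 (by simp))).unop
  exact (ShortComplex.moduleCat_exact_iff _).1 h z hz

end OppositeHomology

section ExtConnecting

variable {R : Type u} [CommRing R] {S : ShortComplex (ModuleCat.{u} R)} (hS : S.ShortExact)
  (M : ModuleCat.{u} R)

/-- The functor `Hom(-, M)`, valued in the opposite category. -/
abbrev homOp : ModuleCat.{u} R ⥤ (ModuleCat.{u} R)ᵒᵖ :=
  ((linearYoneda R (ModuleCat.{u} R)).obj M).rightOp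

/-- The connecting map `Hom(K, M) → Ext¹(A, M)` of a short exact sequence `0 → K → P → A → 0`. -/
def extConnecting : (S.X₁ ⟶ M) →ₗ[R] ((Ext R (ModuleCat.{u} R) 1).obj (op S.X₃)).obj M :=
  (connecting hS (projectiveResolution S.X₃) (homOp M)).unop.hom

theorem extConnecting_naturality {S' : ShortComplex (ModuleCat.{u} R)} (hS' : S'.ShortExact)
    (τ : S ⟶ S') (κ : S'.X₁ ⟶ M) :
    (((Ext R (ModuleCat.{u} R) 1).map τ.τ₃.op).app M).hom (extConnecting hS' M κ) =
      extConnecting hS M (τ.τ₁ ≫ κ) := by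
  have h := connecting_naturality hS (projectiveResolution S.X₃) (homOp M) hS' τ
    (projectiveResolution S'.X₃)
  exact LinearMap.congr_fun (congrArg (fun x => x.unop.hom) h) κ

theorem extConnecting_naturality_right {M' : ModuleCat.{u} R} (φ : M ⟶ M') (κ : S.X₁ ⟶ M) :
    (((Ext R (ModuleCat.{u} R) 1).obj (op S.X₃)).map φ).hom (extConnecting hS M κ) =
      extConnecting hS M' (κ ≫ φ) := by
  have h := connecting_naturality_functor hS (projectiveResolution S.X₃)
    (NatTrans.rightOp ((linearYoneda R (ModuleCat.{u} R)).map φ))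
  exact LinearMap.congr_fun (congrArg (fun x => x.unop.hom) h) κ

variable (P : ProjectiveResolution S.X₃)

theorem pOpcycles_unop_opcyclesToObj_unop (κ : S.X₁ ⟶ M) :
    ((mapComplex (homOp M) P).pOpcycles 1).unop.hom ((opcyclesToObj hS P (homOp M)).unop.hom κ) =
      (liftOne hS P ≫ κ : P.complex.X 1 ⟶ M) :=
  LinearMap.congr_fun (congrArg (fun x => x.unop.hom) (pOpcycles_opcyclesToObj hS P (homOp M))) κ

theorem pOpcycles_unop_fromOpcycles_unop (ψ : P.complex.X 0 ⟶ M) :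
    ((mapComplex (homOp M) P).pOpcycles 1).unop.hom
      (((mapComplex (homOp M) P).fromOpcycles 1 0).unop.hom ψ) =
      (P.complex.d 1 0 ≫ ψ : P.complex.X 1 ⟶ M) :=
  LinearMap.congr_fun (congrArg (fun x => x.unop.hom)
    ((mapComplex (homOp M) P).p_fromOpcycles 1 0)) ψ

theorem homologyι_unop_fromOpcycles_unop (ψ : P.complex.X 0 ⟶ M) :
    ((mapComplex (homOp M) P).homologyι 1).unop.hom
      (((mapComplex (homOp M) P).fromOpcycles 1 0).unop.hom ψ) = 0 :=
  LinearMap.congr_fun (congrArg (fun x => x.unop.hom)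
    ((mapComplex (homOp M) P).homologyι_comp_fromOpcycles 1 0)) ψ

theorem d_comp_pOpcycles_unop (z : ((mapComplex (homOp M) P).opcycles 1).unop) :
    (P.complex.d 2 1 ≫ (((mapComplex (homOp M) P).pOpcycles 1).unop.hom z :
      P.complex.X 1 ⟶ M) : P.complex.X 2 ⟶ M) = 0 :=
  LinearMap.congr_fun (congrArg (fun x => x.unop.hom)
    ((mapComplex (homOp M) P).d_pOpcycles 2 1)) z

theorem exact_d_augmentation :
    Function.Exact (P.complex.d 1 0).hom (augmentation P).hom :=
  (ShortComplex.ShortExact.moduleCat_exact_iff_function_exact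
    (ShortComplex.mk _ _ (d_comp_augmentation P))).1 P.exact₀

theorem exists_section_comparison [Projective S.X₂] :
    ∃ g : S.X₂ ⟶ P.complex.X 0, g ≫ augmentation P = S.g := by
  have : Epi (augmentation P) := inferInstanceAs (Epi (P.π.f 0))
  exact ⟨Projective.factorThru S.g (augmentation P), Projective.factorThru_comp _ _⟩

/-- A class is represented by a cocycle on the resolution. As `S.X₂` is projective, `S.g` lifts to
degree zero, and `exists_cocycle_comparison` moves the cocycle by a coboundary to one induced from
`S.X₁`. -/
theorem extConnecting_surjective [Projective S.X₂] :
    Function.Surjective (extConnecting hS M) := by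
  intro y
  let P := projectiveResolution S.X₃
  let e := (P.isoLeftDerivedObj (homOp M) 1).unop
  obtain ⟨z, hz⟩ := homologyι_unop_surjective (mapComplex (homOp M) P) (e.inv.hom y)
  let φ : P.complex.X 1 ⟶ M := ((mapComplex (homOp M) P).pOpcycles 1).unop.hom z
  have hφ : P.complex.d 2 1 ≫ φ = 0 := d_comp_pOpcycles_unop M P z
  have hφ' (x : P.complex.X 1) (hx : (P.complex.d 1 0).hom x = 0) : φ.hom x = 0 := by
    obtain ⟨w, rfl⟩ := (ShortComplex.moduleCat_exact_iff _).1 (P.exact_succ 0) x hx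
    exact LinearMap.congr_fun (congrArg ModuleCat.Hom.hom hφ) w
  obtain ⟨g, hg⟩ := exists_section_comparison P
  obtain ⟨κ, ψ, h⟩ := exists_cocycle_comparison (exact_d_augmentation P)
    ((ShortComplex.ShortExact.moduleCat_exact_iff_function_exact S).1 hS.exact)
    (congrArg ModuleCat.Hom.hom (liftZero_comp hS P)) (congrArg ModuleCat.Hom.hom hg)
    (congrArg ModuleCat.Hom.hom (liftOne_comp hS P)) φ.hom hφ'
  refine ⟨ModuleCat.ofHom κ, ?_⟩
  have hw : z - (opcyclesToObj hS P (homOp M)).unop.hom (ModuleCat.ofHom κ) =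
      ((mapComplex (homOp M) P).fromOpcycles 1 0).unop.hom (ModuleCat.ofHom ψ) := by
    apply pOpcycles_unop_injective
    rw [map_sub]
    refine (congrArg (φ - ·) (pOpcycles_unop_opcyclesToObj_unop hS M P _)).trans
      (Eq.trans ?_ (pOpcycles_unop_fromOpcycles_unop M P _).symm)
    exact ModuleCat.hom_ext h
  have h0 := congrArg ((mapComplex (homOp M) P).homologyι 1).unop.hom hw
  rw [map_sub] at h0
  have h1 := sub_eq_zero.1 (h0.trans (homologyι_unop_fromOpcycles_unop M P _))
  have h2 : extConnecting hS M (ModuleCat.ofHom κ) =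
    e.hom.hom (((mapComplex (homOp M) P).homologyι 1).unop.hom
      ((opcyclesToObj hS P (homOp M)).unop.hom (ModuleCat.ofHom κ))) := rfl
  rw [h2, ← h1, hz]
  exact LinearMap.congr_fun (congrArg ModuleCat.Hom.hom e.inv_hom_id) y

/-- The class vanishes when `liftOne ≫ κ` is a coboundary, which `exists_extension` turns into an
extension of `κ`. Conversely, an extension `ε` exhibits the coboundary of `liftZero ≫ ε`. -/
theorem extConnecting_eq_zero_iff [Projective S.X₂] (κ : S.X₁ ⟶ M) :
    extConnecting hS M κ = 0 ↔ ∃ ε : S.X₂ ⟶ M, S.f ≫ ε = κ := by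
  let P := projectiveResolution S.X₃
  let e := (P.isoLeftDerivedObj (homOp M) 1).unop
  have h2 : extConnecting hS M κ =
    e.hom.hom (((mapComplex (homOp M) P).homologyι 1).unop.hom
      ((opcyclesToObj hS P (homOp M)).unop.hom κ)) := rfl
  constructor
  · intro h
    have h0 : ((mapComplex (homOp M) P).homologyι 1).unop.hom
        ((opcyclesToObj hS P (homOp M)).unop.hom κ) = 0 := by
      have := LinearMap.congr_fun (congrArg ModuleCat.Hom.hom e.hom_inv_id)
        (((mapComplex (homOp M) P).homologyι 1).unop.hom
          ((opcyclesToObj hS P (homOp M)).unop.hom κ))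
      refine this.symm.trans ((congrArg e.inv.hom (h2.symm.trans h)).trans (map_zero _))
    obtain ⟨ψ, hψ⟩ := exists_of_homologyι_unop_eq_zero _ _ h0
    have h3 := congrArg ((mapComplex (homOp M) P).pOpcycles 1).unop.hom hψ
    have h4 : liftOne hS P ≫ κ = P.complex.d 1 0 ≫ ψ :=
      (pOpcycles_unop_opcyclesToObj_unop hS M P κ).symm.trans
        (h3.symm.trans (pOpcycles_unop_fromOpcycles_unop M P ψ))
    obtain ⟨g, hg⟩ := exists_section_comparison P
    obtain ⟨ε, hε⟩ := exists_extension (exact_d_augmentation P) hS.moduleCat_injective_f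
      ((ShortComplex.ShortExact.moduleCat_exact_iff_function_exact S).1 hS.exact)
      (congrArg ModuleCat.Hom.hom (liftZero_comp hS P)) (congrArg ModuleCat.Hom.hom hg)
      (congrArg ModuleCat.Hom.hom (liftOne_comp hS P)) κ.hom (ModuleCat.Hom.hom ψ)
      (congrArg ModuleCat.Hom.hom h4)
    exact ⟨ModuleCat.ofHom ε, ModuleCat.hom_ext hε⟩
  · rintro ⟨ε, rfl⟩
    have hw : (opcyclesToObj hS P (homOp M)).unop.hom (S.f ≫ ε) =
        ((mapComplex (homOp M) P).fromOpcycles 1 0).unop.hom (liftZero hS P ≫ ε) := by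
      apply pOpcycles_unop_injective
      refine (pOpcycles_unop_opcyclesToObj_unop hS M P _).trans
        (Eq.trans ?_ (pOpcycles_unop_fromOpcycles_unop M P _).symm)
      rw [← Category.assoc, liftOne_comp, Category.assoc]
    rw [h2, hw]
    exact (congrArg e.hom.hom (homologyι_unop_fromOpcycles_unop M P _)).trans (map_zero _)

end ExtConnecting

/-! ### The kernel of `M → T(M)` -/

section Unit

variable {R : Type*} [CommRing R] (m : Ideal R) (M : Type*) [AddCommGroup M] [Module R M]

instance :
    DirectedSystem (fun α : ℕ => ↥(m ^ α) →ₗ[R] M) (restrictPow m M · · ·) where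
  map_self _ _ := rfl
  map_map _ _ _ _ _ _ := rfl

theorem unit_eq_of (β : ℕ) (x : M) : GlobalTransform.unit m M x =
    Module.DirectLimit.of R ℕ (fun α : ℕ => ↥(m ^ α) →ₗ[R] M) (restrictPow m M) β
      ((LinearMap.toSpanSingleton R M x) ∘ₗ (m ^ β).subtype) :=
  (Module.DirectLimit.of_f (f := restrictPow m M) (hij := Nat.zero_le β)).symm

/-- The kernel of `M → T(M)` is the `m`-power torsion of `M`. -/
theorem unit_eq_zero_iff (x : M) :
    GlobalTransform.unit m M x = 0 ↔ ∃ β : ℕ, ∀ r ∈ m ^ β, r • x = 0 := by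
  constructor
  · intro h
    rw [unit_eq_of m M 0] at h
    obtain ⟨β, hβ, h0⟩ := Module.DirectLimit.of.zero_exact h
    exact ⟨β, fun r hr => LinearMap.congr_fun h0 ⟨r, hr⟩⟩
  · rintro ⟨β, hβ⟩
    rw [unit_eq_of m M β]
    have : (LinearMap.toSpanSingleton R M x) ∘ₗ (m ^ β).subtype = 0 :=
      LinearMap.ext fun r => hβ r r.2
    rw [this, map_zero]

end Unit

/-! ### The exact sequence `M → T(M) → H¹(M) → 0` -/

section LocalCohomology

variable {R : Type u} [CommRing R] (m : Ideal R)

/-- The short complex `m ^ β → R → R ⧸ m ^ β`. -/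
abbrev powComplex (β : ℕ) : ShortComplex (ModuleCat.{u} R) :=
  ShortComplex.mk (ModuleCat.ofHom (m ^ β).subtype) (ModuleCat.ofHom (Submodule.mkQ (m ^ β)))
    (by ext x; simp [Ideal.Quotient.eq_zero_iff_mem])

theorem powComplex_shortExact (β : ℕ) : (powComplex m β).ShortExact where
  exact := (ShortComplex.ShortExact.moduleCat_exact_iff_function_exact _).2
    (LinearMap.exact_subtype_mkQ (m ^ β))
  mono_f := (ModuleCat.mono_iff_injective _).2 (Submodule.subtype_injective _)
  epi_g := (ModuleCat.epi_iff_surjective _).2 (Submodule.mkQ_surjective _)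

/-- The transition map between the short complexes of two powers of `m`. -/
def powComplexMap {i j : ℕ} (h : i ≤ j) : powComplex m j ⟶ powComplex m i where
  τ₁ := ModuleCat.ofHom (Submodule.inclusion (Ideal.pow_le_pow_right h))
  τ₂ := 𝟙 _
  τ₃ := ModuleCat.ofHom (Submodule.mapQ _ _ LinearMap.id (Ideal.pow_le_pow_right h))
  comm₁₂ := rfl
  comm₂₃ := rfl

instance (β : ℕ) : Projective (powComplex m β).X₂ :=
  inferInstanceAs (Projective (ModuleCat.of R R))

variable (M : ModuleCat.{u} R)

/-- The map from `Ext¹(R ⧸ m ^ β, M)` to the first local cohomology module. -/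
def extToLocalCohomology (β : ℕ) :
    ((Ext R (ModuleCat.{u} R) 1).obj (op (powComplex m β).X₃)).obj M ⟶
      (localCohomology m 1).obj M :=
  (colimit.ι (localCohomology.diagram (localCohomology.idealPowersDiagram m) 1)
    (op (op β))).app M

/-- The value at `M` of the colimit cocone that defines local cohomology. -/
def localCohomologyIsColimit :
    IsColimit (((evaluation _ _).obj M).mapCocone
      (colimit.cocone (localCohomology.diagram (localCohomology.idealPowersDiagram m) 1))) :=
  isColimitOfPreserves _ (colimit.isColimit _)

instance : PreservesColimitsOfShape ℕᵒᵖᵒᵖ (forget (ModuleCat.{u} R)) :=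
  have : PreservesFilteredColimitsOfSize.{0, 0} (forget (ModuleCat.{u} R)) :=
    preservesSmallestFilteredColimits_of_preservesFilteredColimits _
  PreservesFilteredColimitsOfSize.preserves_filtered_colimits _

theorem exists_extToLocalCohomology_eq (y : (localCohomology m 1).obj M) :
    ∃ β x, (extToLocalCohomology m M β).hom x = y := by
  obtain ⟨⟨⟨β⟩⟩, x, hx⟩ :=
    Concrete.isColimit_exists_rep _ (localCohomologyIsColimit m M) y
  exact ⟨β, x, hx⟩

theorem extToLocalCohomology_naturality {i j : ℕ} (h : i ≤ j)
    (x : ((Ext R (ModuleCat.{u} R) 1).obj (op (powComplex m i).X₃)).obj M) :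
    (extToLocalCohomology m M j).hom
      ((((Ext R (ModuleCat.{u} R) 1).map (powComplexMap m h).τ₃.op).app M).hom x) =
    (extToLocalCohomology m M i).hom x := by
  have hw := colimit.w (localCohomology.diagram (localCohomology.idealPowersDiagram m) 1)
    (homOfLE h).op.op
  exact LinearMap.congr_fun (congrArg (fun t => (t.app M).hom) hw) x

theorem extToLocalCohomology_naturality_right {M' : ModuleCat.{u} R} (φ : M ⟶ M') (β : ℕ)
    (x : ((Ext R (ModuleCat.{u} R) 1).obj (op (powComplex m β).X₃)).obj M) :
    ((localCohomology m 1).map φ).hom ((extToLocalCohomology m M β).hom x) =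
    (extToLocalCohomology m M' β).hom
      (((Ext R (ModuleCat.{u} R) 1).obj (op (powComplex m β).X₃)).map φ |>.hom x) := by
  have hw := (colimit.ι (localCohomology.diagram (localCohomology.idealPowersDiagram m) 1)
    (op (op β))).naturality φ
  exact (LinearMap.congr_fun (congrArg ModuleCat.Hom.hom hw) x).symm

theorem exists_map_eq_zero (i : ℕ)
    (x : ((Ext R (ModuleCat.{u} R) 1).obj (op (powComplex m i).X₃)).obj M)
    (hx : (extToLocalCohomology m M i).hom x = 0) :
    ∃ (j : ℕ) (h : i ≤ j),
      ((((Ext R (ModuleCat.{u} R) 1).map (powComplexMap m h).τ₃.op).app M).hom x) = 0 := by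
  obtain ⟨⟨⟨j⟩⟩, f, g, hfg⟩ := (Concrete.isColimit_rep_eq_iff_exists _
    (localCohomologyIsColimit m M) (i := op (op i)) (j := op (op i)) x 0).1
    (hx.trans (map_zero (extToLocalCohomology m M i).hom).symm)
  refine ⟨j, leOfHom f.unop.unop, ?_⟩
  exact hfg.trans (map_zero _)

/-- The map `Hom(m ^ β, M) → H¹(M)`. -/
def homToLocalCohomology (β : ℕ) : (↥(m ^ β) →ₗ[R] M) →ₗ[R] (localCohomology m 1).obj M :=
  (extToLocalCohomology m M β).hom ∘ₗ extConnecting (powComplex_shortExact m β) M ∘ₗ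
    (ModuleCat.homLinearEquiv (S := R) (M := (powComplex m β).X₁) (N := M)).symm.toLinearMap

theorem homToLocalCohomology_apply (β : ℕ) (φ : ↥(m ^ β) →ₗ[R] M) :
    homToLocalCohomology m M β φ = (extToLocalCohomology m M β).hom
      (extConnecting (powComplex_shortExact m β) M (ModuleCat.ofHom φ)) := rfl

theorem homToLocalCohomology_restrictPow {i j : ℕ} (h : i ≤ j) (φ : ↥(m ^ i) →ₗ[R] M) :
    homToLocalCohomology m M j (restrictPow m M i j h φ) = homToLocalCohomology m M i φ := by
  rw [homToLocalCohomology_apply, homToLocalCohomology_apply,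
    ← extToLocalCohomology_naturality m M h]
  congr 1
  exact (extConnecting_naturality (powComplex_shortExact m j) M (powComplex_shortExact m i)
    (powComplexMap m h) (ModuleCat.ofHom φ)).symm

theorem exists_homToLocalCohomology_eq (y : (localCohomology m 1).obj M) :
    ∃ β φ, homToLocalCohomology m M β φ = y := by
  obtain ⟨β, x, rfl⟩ := exists_extToLocalCohomology_eq m M y
  obtain ⟨φ, rfl⟩ := extConnecting_surjective (powComplex_shortExact m β) M x
  exact ⟨β, φ.hom, rfl⟩

/-- The `Ext¹` class dies at a finite stage `j`; there the restriction extends to `R`, and a map out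
of `R` is determined by its value `x` at `1`. -/
theorem exists_restrictPow_extension (i : ℕ) (φ : ↥(m ^ i) →ₗ[R] M)
    (h : homToLocalCohomology m M i φ = 0) :
    ∃ (j : ℕ) (h : i ≤ j) (x : M), ∀ r : ↥(m ^ j), restrictPow m M i j h φ r = (r : R) • x := by
  obtain ⟨j, hij, hj⟩ := exists_map_eq_zero m M i
    (extConnecting (powComplex_shortExact m i) M (ModuleCat.ofHom φ)) h
  rw [extConnecting_naturality (powComplex_shortExact m j) M (powComplex_shortExact m i)
    (powComplexMap m hij), extConnecting_eq_zero_iff] at hj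
  obtain ⟨ε, hε⟩ := hj
  refine ⟨j, hij, ε.hom (1 : R), fun r => ?_⟩
  have h1 : ε.hom (r : R) = restrictPow m M i j hij φ r :=
    LinearMap.congr_fun (congrArg ModuleCat.Hom.hom hε) r
  have h2 := ε.hom.map_smul (r : R) (1 : R)
  rw [smul_eq_mul, mul_one] at h2
  exact h1.symm.trans h2

theorem homToLocalCohomology_smul (x : M) :
    homToLocalCohomology m M 0 ((LinearMap.toSpanSingleton R M x) ∘ₗ (m ^ 0).subtype) = 0 := by
  have h : extConnecting (powComplex_shortExact m 0) M
      (ModuleCat.ofHom ((LinearMap.toSpanSingleton R M x) ∘ₗ (m ^ 0).subtype)) = 0 :=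
    (extConnecting_eq_zero_iff (powComplex_shortExact m 0) M _).2
      ⟨ModuleCat.ofHom (LinearMap.toSpanSingleton R M x), rfl⟩
  rw [homToLocalCohomology_apply, h, map_zero]

/-- The connecting map `T(M) → H¹(M)`. -/
def transformToLocalCohomology : GlobalTransform m M →ₗ[R] (localCohomology m 1).obj M :=
  Module.DirectLimit.lift R ℕ _ _ (homToLocalCohomology m M)
    (fun _ _ h φ => homToLocalCohomology_restrictPow m M h φ)

theorem transformToLocalCohomology_of (β : ℕ) (φ : ↥(m ^ β) →ₗ[R] M) :
    transformToLocalCohomology m M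
      (Module.DirectLimit.of R ℕ (fun α : ℕ => ↥(m ^ α) →ₗ[R] M) (restrictPow m M) β φ) =
      homToLocalCohomology m M β φ :=
  Module.DirectLimit.lift_of _ _ _

theorem transformToLocalCohomology_surjective :
    Function.Surjective (transformToLocalCohomology m M) := by
  intro y
  obtain ⟨β, φ, rfl⟩ := exists_homToLocalCohomology_eq m M y
  exact ⟨_, transformToLocalCohomology_of m M β φ⟩

theorem exact_unit_transformToLocalCohomology :
    Function.Exact (GlobalTransform.unit m M) (transformToLocalCohomology m M) := by
  intro y
  constructor
  · intro hy
    obtain ⟨i, φ, rfl⟩ := Module.DirectLimit.exists_of y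
    rw [transformToLocalCohomology_of] at hy
    obtain ⟨j, hij, x, hx⟩ := exists_restrictPow_extension m M i φ hy
    refine ⟨x, ?_⟩
    rw [unit_eq_of m M j, ← Module.DirectLimit.of_f (f := restrictPow m M) (hij := hij) (x := φ)]
    congr 1
    ext r
    exact (hx r).symm
  · rintro ⟨x, rfl⟩
    rw [unit_eq_of m M 0, transformToLocalCohomology_of]
    exact homToLocalCohomology_smul m M x

theorem transformToLocalCohomology_naturality {M' : ModuleCat.{u} R} (f : M ⟶ M')
    (y : GlobalTransform m M) :
    transformToLocalCohomology m M' (GlobalTransform.map m f.hom y) =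
      ((localCohomology m 1).map f).hom (transformToLocalCohomology m M y) := by
  obtain ⟨i, φ, rfl⟩ := Module.DirectLimit.exists_of y
  rw [transformToLocalCohomology_of]
  refine (congrArg _ (Module.DirectLimit.map_apply_of _ _ _)).trans ?_
  rw [transformToLocalCohomology_of, homToLocalCohomology_apply, homToLocalCohomology_apply,
    extToLocalCohomology_naturality_right, extConnecting_naturality_right]
  rfl

end LocalCohomology

/-! ### Finite length of the torsion kernels -/

section Artinian

variable {R : Type*} [CommRing R] [IsLocalRing R] [IsNoetherianRing R]

theorem isArtinianRing_quotient_maximalIdeal_pow (β : ℕ) :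
    IsArtinianRing (R ⧸ maximalIdeal R ^ β) := by
  rw [isArtinianRing_iff_isNoetherianRing_krullDimLE_zero, Ring.krullDimLE_iff]
  refine ⟨inferInstance, not_lt.1 fun h => ?_⟩
  obtain ⟨P, hP, hle, hPm⟩ := (krullDim_quotient_pos_iff _).1 h
  exact hPm ((maximalIdeal.isMaximal R).eq_of_le hP.ne_top (hP.le_of_pow_le hle) ▸
    maximalIdeal.isMaximal R)

/-- A finitely generated module over a Noetherian local ring that is killed by a power of the
maximal ideal is Artinian. -/
theorem isArtinian_of_maximalIdeal_pow_smul_eq_zero {K : Type*} [AddCommGroup K] [Module R K]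
    [Module.Finite R K] (β : ℕ) (h : ∀ r ∈ maximalIdeal R ^ β, ∀ x : K, r • x = 0) :
    IsArtinian R K := by
  have htor : Module.IsTorsionBySet R K (maximalIdeal R ^ β : Ideal R) := fun x r => h r r.2 x
  let := htor.module
  have : IsScalarTower R (R ⧸ maximalIdeal R ^ β) K := htor.isScalarTower
  have := isArtinianRing_quotient_maximalIdeal_pow (R := R) β
  have : Module.Finite (R ⧸ maximalIdeal R ^ β) K := Module.Finite.of_restrictScalars_finite R _ _
  have : IsArtinian (R ⧸ maximalIdeal R ^ β) K := inferInstance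
  exact isArtinian_of_surjective_algebraMap (R := R ⧸ maximalIdeal R ^ β)
    Ideal.Quotient.mk_surjective

/-- The kernel of `M → T(M)` has finite length if `M` is finitely generated. -/
theorem isArtinian_ker_unit (M : Type*) [AddCommGroup M] [Module R M] [Module.Finite R M] :
    IsArtinian R (LinearMap.ker (GlobalTransform.unit (maximalIdeal R) M)) := by
  let f : ℕ →o Submodule R M :=
    { toFun := fun β => Submodule.torsionBySet R M (maximalIdeal R ^ β : Ideal R)
      monotone' := fun i j h => Submodule.torsionBySet_le_torsionBySet_of_subset
        (Ideal.pow_le_pow_right h) }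
  -- The torsion submodules stabilize, so one power of the maximal ideal kills the whole kernel.
  obtain ⟨n, hn⟩ := monotone_stabilizes_iff_noetherian.2 (inferInstance : IsNoetherian R M) f
  refine isArtinian_of_maximalIdeal_pow_smul_eq_zero n fun r hr x => ?_
  obtain ⟨β, hβ⟩ := (unit_eq_zero_iff (maximalIdeal R) M (x : M)).1 x.2
  have h1 : (x : M) ∈ f β := (Submodule.mem_torsionBySet_iff _ _).2 fun a => hβ a a.2
  have h2 : (x : M) ∈ f n := hn (max n β) (le_max_left _ _) ▸ f.monotone (le_max_right n β) h1
  exact Subtype.ext ((Submodule.mem_torsionBySet_iff _ _).1 h2 ⟨r, hr⟩)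

end Artinian

/-! ### Mittag-Leffler arguments -/

section MittagLeffler

variable {R : Type*} [CommRing R] {A : ℕ → Type*} [∀ n, AddCommGroup (A n)] [∀ n, Module R (A n)]

/-- A sequence of elements of an inverse system that is compatible with the successive transition
maps is compatible with all of them. -/
theorem compatible_of_succ (p : ∀ i j, i ≤ j → A j →ₗ[R] A i)
    (hid : ∀ i x, p i i le_rfl x = x)
    (hcomp : ∀ i j k (hij : i ≤ j) (hjk : j ≤ k) x, p i j hij (p j k hjk x) = p i k (hij.trans hjk) x)
    (x : ∀ n, A n) (hx : ∀ n, p n (n + 1) n.le_succ (x (n + 1)) = x n) (i j : ℕ) (h : i ≤ j) :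
    p i j h (x j) = x i := by
  induction j, h using Nat.le_induction with
  | base => exact hid i _
  | succ n hin ih => rw [← hcomp i n (n + 1) hin n.le_succ, hx, ih]

/-- Successive choice along an inverse system. -/
theorem exists_compatible_sequence (p : ∀ i j, i ≤ j → A j →ₗ[R] A i)
    (hid : ∀ i x, p i i le_rfl x = x)
    (hcomp : ∀ i j k (hij : i ≤ j) (hjk : j ≤ k) x, p i j hij (p j k hjk x) = p i k (hij.trans hjk) x)
    (E : ∀ n, Set (A n)) (h0 : (E 0).Nonempty)
    (hE : ∀ n, ∀ x ∈ E n, ∃ y ∈ E (n + 1), p n (n + 1) n.le_succ y = x) :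
    ∃ x ∈ invLim p, ∀ n, x n ∈ E n := by
  choose! s hs hps using hE
  let x (n : ℕ) : A n := Nat.rec h0.some (fun n y => s n y) n
  have hxE (n : ℕ) : x n ∈ E n := by
    induction n with
    | zero => exact h0.some_mem
    | succ n ih => exact hs n _ ih
  exact ⟨x, compatible_of_succ p hid hcomp x fun n => hps n _ (hxE n), hxE⟩

/-- An inverse system of cosets of Artinian submodules has a compatible family of elements. -/
theorem exists_compatible_sequence_of_isArtinian (p : ∀ i j, i ≤ j → A j →ₗ[R] A i)
    (hid : ∀ i x, p i i le_rfl x = x)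
    (hcomp : ∀ i j k (hij : i ≤ j) (hjk : j ≤ k) x, p i j hij (p j k hjk x) = p i k (hij.trans hjk) x)
    (K : ∀ n, Submodule R (A n)) [∀ n, IsArtinian R (K n)]
    (hK : ∀ i j (h : i ≤ j), (K j).map (p i j h) ≤ K i)
    (X : ∀ n, Set (A n)) (hne : ∀ n, (X n).Nonempty)
    (hX : ∀ i j (h : i ≤ j), ∀ x ∈ X j, p i j h x ∈ X i)
    (hsub : ∀ n, ∀ x ∈ X n, ∀ y ∈ X n, x - y ∈ K n)
    (hadd : ∀ n, ∀ x ∈ X n, ∀ k ∈ K n, x + k ∈ X n) :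
    ∃ x ∈ invLim p, ∀ n, x n ∈ X n := by
  -- The images of the `K j` form a decreasing chain in the Artinian module `K i`, so they
  -- stabilize.
  have hstab (i : ℕ) : ∃ N, ∀ j j' (hij : i ≤ j) (hjj' : j ≤ j'), N ≤ j →
      ∀ k ∈ K j, ∃ k' ∈ K j', p i j hij k = p i j' (hij.trans hjj') k' := by
    let f : ℕ →o (Submodule R (K i))ᵒᵈ :=
      { toFun := fun n => OrderDual.toDual
          (((K (i + n)).map (p i (i + n) (Nat.le_add_right i n))).comap (K i).subtype)
        monotone' := by
          intro a b hab
          refine Submodule.comap_mono ?_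
          rintro _ ⟨k, hk, rfl⟩
          refine ⟨p (i + a) (i + b) (Nat.add_le_add_left hab i) k, hK _ _ _ ⟨k, hk, rfl⟩, ?_⟩
          exact hcomp _ _ _ _ _ _ }
    obtain ⟨n, hn⟩ := IsArtinian.monotone_stabilizes f
    refine ⟨i + n, fun j j' hij hjj' hNj k hk => ?_⟩
    obtain ⟨a, rfl⟩ := Nat.exists_eq_add_of_le hij
    obtain ⟨b, rfl⟩ := Nat.exists_eq_add_of_le (hij.trans hjj')
    have hab : f a = f b := (hn a (by omega)).symm.trans (hn b (by omega))
    have hmem : (⟨p i (i + a) hij k, hK _ _ _ ⟨k, hk, rfl⟩⟩ : K i) ∈ OrderDual.ofDual (f a) :=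
      ⟨k, hk, rfl⟩
    rw [hab] at hmem
    obtain ⟨k', hk', h⟩ := hmem
    exact ⟨k', hk', h.symm⟩
  choose N hN using hstab
  -- The elements that lift to every later stage. Unlike the `X i`, these sets have surjective
  -- transition maps.
  let E (i : ℕ) : Set (A i) := {x | ∀ j (h : i ≤ j), ∃ w ∈ X j, p i j h w = x}
  have hlift (i j : ℕ) (hij : i ≤ j) (hNj : N i ≤ j) (w : A j) (hw : w ∈ X j) :
      p i j hij w ∈ E i := by
    intro j' hj'
    rcases le_total j' j with h | h
    · exact ⟨p j' j h w, hX _ _ _ _ hw, hcomp _ _ _ _ _ _⟩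
    -- Any `v` in `X j'` can be corrected by an element of `K j'` with the same image in `A i` as `w
    -- - p j j' h v`.
    · obtain ⟨v, hv⟩ := hne j'
      obtain ⟨k', hk', hk⟩ := hN i j j' hij h hNj (w - p j j' h v) (hsub _ _ hw _ (hX _ _ _ _ hv))
      refine ⟨v + k', hadd _ _ hv _ hk', ?_⟩
      rw [map_add, ← hk, map_sub, hcomp]
      abel
  obtain ⟨x, hx, hxE⟩ := exists_compatible_sequence p hid hcomp E
    ⟨_, hlift 0 (N 0) (Nat.zero_le _) le_rfl _ (hne (N 0)).some_mem⟩ (by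
      intro n x hx
      obtain ⟨w, hw, rfl⟩ := hx (max (n + 1) (N (n + 1))) (n.le_succ.trans (le_max_left _ _))
      exact ⟨p (n + 1) _ (le_max_left _ _) w, hlift _ _ _ (le_max_right _ _) _ hw,
        hcomp _ _ _ _ _ _⟩)
  refine ⟨x, hx, fun n => ?_⟩
  obtain ⟨w, hw, h⟩ := hxE n n le_rfl
  rwa [← h, hid]

end MittagLeffler

/-! ### The inverse systems and the completion -/

section Systems

variable {R : Type u} [CommRing R] (I : Ideal R)

theorem proj_surjective (i j : ℕ) (h : i ≤ j) : Function.Surjective (proj I i j h) :=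
  Ideal.Quotient.factor_surjective (Ideal.pow_le_pow_right h)

theorem proj_mk (i j : ℕ) (h : i ≤ j) (r : R) :
    proj I i j h (Ideal.Quotient.mk _ r) = Ideal.Quotient.mk _ r := rfl

theorem proj_self (i : ℕ) (x : R ⧸ I ^ i) : proj I i i le_rfl x = x := by
  obtain ⟨r, rfl⟩ := Ideal.Quotient.mk_surjective x
  rfl

theorem proj_proj (i j k : ℕ) (hij : i ≤ j) (hjk : j ≤ k) (x : R ⧸ I ^ k) :
    proj I i j hij (proj I j k hjk x) = proj I i k (hij.trans hjk) x := by
  obtain ⟨r, rfl⟩ := Ideal.Quotient.mk_surjective x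
  rfl

theorem GlobalTransform.map_of {M N : Type*} [AddCommGroup M] [Module R M] [AddCommGroup N]
    [Module R N] (m : Ideal R) (φ : M →ₗ[R] N) (α : ℕ) (f : ↥(m ^ α) →ₗ[R] M) :
    GlobalTransform.map m φ
      (Module.DirectLimit.of R ℕ (fun α : ℕ => ↥(m ^ α) →ₗ[R] M) (restrictPow m M) α f) =
      Module.DirectLimit.of R ℕ (fun α : ℕ => ↥(m ^ α) →ₗ[R] N) (restrictPow m N) α (φ ∘ₗ f) :=
  Module.DirectLimit.map_apply_of _ _ _

theorem map_proj_self (m : Ideal R) (i : ℕ) (x : GlobalTransform m (R ⧸ I ^ i)) :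
    GlobalTransform.map m (proj I i i le_rfl) x = x := by
  obtain ⟨α, f, rfl⟩ := Module.DirectLimit.exists_of x
  rw [GlobalTransform.map_of]
  congr 1
  exact LinearMap.ext fun r => proj_self I i _

theorem map_proj_proj (m : Ideal R) (i j k : ℕ) (hij : i ≤ j) (hjk : j ≤ k)
    (x : GlobalTransform m (R ⧸ I ^ k)) :
    GlobalTransform.map m (proj I i j hij) (GlobalTransform.map m (proj I j k hjk) x) =
      GlobalTransform.map m (proj I i k (hij.trans hjk)) x := by
  obtain ⟨α, f, rfl⟩ := Module.DirectLimit.exists_of x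
  rw [GlobalTransform.map_of, GlobalTransform.map_of, GlobalTransform.map_of]
  congr 1
  exact LinearMap.ext fun r => proj_proj I i j k hij hjk _

/-- A compatible family of elements of the `R ⧸ I ^ n` comes from the completion. -/
theorem exists_evalₐ_eq (a : ∀ n, R ⧸ I ^ n) (ha : a ∈ invLim (proj I)) :
    ∃ x : AdicCompletion I R, ∀ n, AdicCompletion.evalₐ I n x = a n := by
  choose r hr using fun n => Ideal.Quotient.mk_surjective (a n)
  have hc (n : ℕ) : r n ≡ r (n + 1) [SMOD (I ^ n • ⊤ : Submodule R R)] := by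
    have h := ha n (n + 1) n.le_succ
    rw [← hr n, ← hr (n + 1), proj_mk, Ideal.Quotient.eq] at h
    rw [SModEq.comm, SModEq.sub_mem]
    simpa using h
  refine ⟨AdicCompletion.mk I R (AdicCompletion.AdicCauchySequence.mk I R r hc), fun n => ?_⟩
  rw [AdicCompletion.evalₐ_mk, ← hr n]
  rfl

theorem evalₐ_eq_zero_iff {I : Ideal R} (hI : I.FG) (n : ℕ) (x : AdicCompletion I R) :
    AdicCompletion.evalₐ I n x = 0 ↔ x ∈ I.map (algebraMap R (AdicCompletion I R)) ^ n := by
  have h1 : x ∈ I.map (algebraMap R (AdicCompletion I R)) ^ n ↔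
      x ∈ (AdicCompletion.eval I R n).ker := by
    rw [← AdicCompletion.pow_smul_top_eq_ker_eval hI, Ideal.smul_top_eq_map, Ideal.map_pow]
    rfl
  -- `eval` takes values modulo `I ^ n • ⊤` and `evalₐ` modulo `I ^ n`; the two inclusions transfer
  -- vanishing.
  have hle : I ^ n • (⊤ : Submodule R R) ≤ I ^ n := by simp
  have hle' : I ^ n ≤ I ^ n • (⊤ : Submodule R R) := by simp
  rw [h1, LinearMap.mem_ker]
  constructor
  · intro h
    rw [← AdicCompletion.factor_evalₐ_eq_eval I x hle', h, map_zero]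
  · intro h
    rw [← AdicCompletion.factor_eval_eq_evalₐ I x hle, h, map_zero]

end Systems

/-! ### Passage to the inverse limit -/

section Main

variable {R : Type u} [CommRing R] [IsLocalRing R]

theorem completionToLimT_apply (I : Ideal R) (x : AdicCompletion I R) (α : ℕ) :
    (completionToLimT I x).1 α =
      GlobalTransform.unit (maximalIdeal R) (R ⧸ I ^ α) (AdicCompletion.evalₐ I α x) := rfl

/-- The connecting maps `T(R ⧸ I ^ α) → H¹(R ⧸ I ^ α)`. -/
def connectingT (I : Ideal R) (α : ℕ) :
    GlobalTransform (maximalIdeal R) (R ⧸ I ^ α) →ₗ[R] H 1 I α :=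
  transformToLocalCohomology (maximalIdeal R) (ModuleCat.of R (R ⧸ I ^ α))

theorem connectingT_surjective (I : Ideal R) (α : ℕ) : Function.Surjective (connectingT I α) :=
  transformToLocalCohomology_surjective _ _

theorem exact_unit_connectingT (I : Ideal R) (α : ℕ) :
    Function.Exact (GlobalTransform.unit (maximalIdeal R) (R ⧸ I ^ α)) (connectingT I α) :=
  exact_unit_transformToLocalCohomology (maximalIdeal R) (ModuleCat.of R (R ⧸ I ^ α))

theorem connectingT_map (I : Ideal R) (i j : ℕ) (h : i ≤ j)
    (y : GlobalTransform (maximalIdeal R) (R ⧸ I ^ j)) :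
    connectingT I i (GlobalTransform.map (maximalIdeal R) (proj I i j h) y) =
      transH 1 I i j h (connectingT I j y) :=
  transformToLocalCohomology_naturality (maximalIdeal R) _ (ModuleCat.ofHom (proj I i j h)) y

/-- The inverse limit of the connecting maps. -/
def limConnecting (I : Ideal R) : limT I →ₗ[R] limH 1 I :=
  LinearMap.codRestrict (limH 1 I)
    ((LinearMap.pi fun α => connectingT I α ∘ₗ LinearMap.proj α) ∘ₗ (limT I).subtype)
    (fun y i j h => by
      change transH 1 I i j h (connectingT I j (y.1 j)) = connectingT I i (y.1 i)
      rw [← connectingT_map, y.2 i j h])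

theorem limConnecting_apply (I : Ideal R) (y : limT I) (α : ℕ) :
    (limConnecting I y).1 α = connectingT I α (y.1 α) := rfl

/-- A preimage at stage `n + 1` misses the one chosen at stage `n` by an element coming from `R ⧸ I
^ n`; lifting that element to `R ⧸ I ^ (n + 1)` corrects it. -/
theorem limConnecting_surjective (I : Ideal R) : Function.Surjective (limConnecting I) := by
  intro z
  obtain ⟨y, hy, hyz⟩ := exists_compatible_sequence
    (fun i j h => GlobalTransform.map (maximalIdeal R) (proj I i j h))
    (map_proj_self I _) (map_proj_proj I _) (fun n => {y | connectingT I n y = z.1 n})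
    (connectingT_surjective I 0 _) (by
      intro n x hx
      obtain ⟨y, hy⟩ := connectingT_surjective I (n + 1) (z.1 (n + 1))
      have h0 : connectingT I n
          (GlobalTransform.map (maximalIdeal R) (proj I n (n + 1) n.le_succ) y - x) = 0 := by
        rw [map_sub, connectingT_map, hy, z.2 n (n + 1) n.le_succ, hx, sub_self]
      obtain ⟨a, ha⟩ := (exact_unit_connectingT I n _).1 h0
      obtain ⟨b, rfl⟩ := proj_surjective I n (n + 1) n.le_succ a
      refine ⟨y - GlobalTransform.unit _ _ b, ?_, ?_⟩
      · rw [Set.mem_ofPred_eq, map_sub, (exact_unit_connectingT I _).apply_apply_eq_zero, sub_zero,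
          hy]
      · rw [map_sub, GlobalTransform.map_unit, ha, sub_sub_cancel])
  exact ⟨⟨y, hy⟩, Subtype.ext (funext hyz)⟩

variable [IsNoetherianRing R]

/-- The preimages of the components of `y` are cosets of the Artinian kernels, so a compatible
choice exists and defines an element of the completion. -/
theorem exact_completionToLimT_limConnecting (I : Ideal R) :
    Function.Exact (completionToLimT I) (limConnecting I) := by
  intro y
  constructor
  · intro hy
    have hy' (α : ℕ) : connectingT I α (y.1 α) = 0 := congrFun (congrArg Subtype.val hy) α
    let unit (n : ℕ) := GlobalTransform.unit (maximalIdeal R) (R ⧸ I ^ n)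
    have (n : ℕ) : IsArtinian R (LinearMap.ker (unit n)) := isArtinian_ker_unit _
    obtain ⟨a, ha, hay⟩ := exists_compatible_sequence_of_isArtinian (proj I) (proj_self I)
      (proj_proj I) (fun n => LinearMap.ker (unit n)) (by
        rintro i j h _ ⟨k, hk, rfl⟩
        have hk' : unit j k = 0 := hk
        change unit i (proj I i j h k) = 0
        rw [← GlobalTransform.map_unit, hk', map_zero])
      (fun n => {a | unit n a = y.1 n})
      (fun n => (exact_unit_connectingT I n _).1 (hy' n))
      (fun i j h x hx => by
        have hx' : unit j x = y.1 j := hx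
        change unit i (proj I i j h x) = _
        rw [← GlobalTransform.map_unit, hx', y.2 i j h])
      (fun n x hx y hy => by
        have hx' : unit n x = _ := hx
        rw [LinearMap.mem_ker, map_sub, hx', sub_eq_zero]
        exact hy.symm)
      (fun n x hx k hk => by
        change unit n (x + k) = _
        rw [map_add, LinearMap.mem_ker.1 hk, add_zero]
        exact hx)
    obtain ⟨x, hx⟩ := exists_evalₐ_eq I a ha
    refine ⟨x, Subtype.ext (funext fun n => ?_)⟩
    rw [completionToLimT_apply, hx]
    exact hay n
  · rintro ⟨x, rfl⟩
    refine Subtype.ext (funext fun n => ?_)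
    exact (exact_unit_connectingT I n).apply_apply_eq_zero _

/-- Both sides say that, for each `α`, a power of the maximal ideal multiplies `x` into the `α`-th
power of the extended ideal. -/
theorem completionToLimT_eq_zero_iff (I : Ideal R) {t : Finset (Ideal (AdicCompletion I R))}
    (ht : Submodule.IsMinimalPrimaryDecomposition (⊥ : Ideal (AdicCompletion I R)) t)
    (x : AdicCompletion I R) :
    completionToLimT I x = 0 ↔ x ∈ uIdeal t (I.map (algebraMap R (AdicCompletion I R))) := by
  have hI : I.FG := (isNoetherianRing_iff_ideal_fg R).1 inferInstance I
  have := isNoetherianRing_adicCompletion I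
  rw [mem_uIdeal_iff (algebraMap R (AdicCompletion I R)) (surjective_mk_comp_algebraMap hI) ht,
    Subtype.ext_iff, funext_iff]
  refine forall_congr' fun α => ?_
  rw [completionToLimT_apply]
  refine (unit_eq_zero_iff _ _ _).trans (exists_congr fun β => forall₂_congr fun r _ => ?_)
  rw [← evalₐ_eq_zero_iff hI, map_mul, AlgHom.commutes, Algebra.smul_def]

/-- The map induced by `completionToLimT` on the quotient by its kernel. -/
def quotientToLimT (I : Ideal R) {t : Finset (Ideal (AdicCompletion I R))}
    (ht : Submodule.IsMinimalPrimaryDecomposition (⊥ : Ideal (AdicCompletion I R)) t) :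
    (AdicCompletion I R ⧸ uIdeal t (I.map (algebraMap R (AdicCompletion I R)))) →ₗ[R] limT I where
  -- The quotient is by an ideal of the completion while the map is linear over `R`, so the lift is
  -- taken additively.
  toFun := QuotientAddGroup.lift _ (completionToLimT I).toAddMonoidHom
    (fun x hx => (completionToLimT_eq_zero_iff I ht x).2 hx)
  map_add' := map_add _
  map_smul' r x := by
    obtain ⟨x, rfl⟩ := Ideal.Quotient.mk_surjective x
    exact map_smul (completionToLimT I) r x

theorem quotientToLimT_mk (I : Ideal R) {t : Finset (Ideal (AdicCompletion I R))}
    (ht : Submodule.IsMinimalPrimaryDecomposition (⊥ : Ideal (AdicCompletion I R)) t)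
    (x : AdicCompletion I R) :
    quotientToLimT I ht (Ideal.Quotient.mk _ x) = completionToLimT I x := rfl

theorem quotientToLimT_injective (I : Ideal R) {t : Finset (Ideal (AdicCompletion I R))}
    (ht : Submodule.IsMinimalPrimaryDecomposition (⊥ : Ideal (AdicCompletion I R)) t) :
    Function.Injective (quotientToLimT I ht) := by
  rw [injective_iff_map_eq_zero]
  intro x hx
  obtain ⟨x, rfl⟩ := Ideal.Quotient.mk_surjective x
  rw [quotientToLimT_mk, completionToLimT_eq_zero_iff I ht] at hx
  exact Ideal.Quotient.eq_zero_iff_mem.2 hx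

end Main

end FormalLC

end

theorem mainTheorem7 (R : Type u) [CommRing R] [IsLocalRing R] [IsNoetherianRing R]
    (I : Ideal R) :
    -- the zero ideal of the completion has a minimal primary decomposition ...
    (∃ t : Finset (Ideal (AdicCompletion I R)),
      Submodule.IsMinimalPrimaryDecomposition (⊥ : Ideal (AdicCompletion I R)) t) ∧
    -- ... and for each of them there is the exact sequence
    ∀ t : Finset (Ideal (AdicCompletion I R)),
      Submodule.IsMinimalPrimaryDecomposition (⊥ : Ideal (AdicCompletion I R)) t →
      ∃ (f : (AdicCompletion I R ⧸
            FormalLC.uIdeal t (I.map (algebraMap R (AdicCompletion I R)))) →ₗ[R]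
            FormalLC.limT I)
        (g : FormalLC.limT I →ₗ[R] FormalLC.limH 1 I),
        -- `f` is induced by the canonical map
        (∀ x : AdicCompletion I R,
          f (Ideal.Quotient.mk _ x) = FormalLC.completionToLimT I x) ∧
        -- `g` is the inverse limit of maps `T(R / I ^ α) → H^1(R / I ^ α)`
        (∃ δ : ∀ α : ℕ, FormalLC.GlobalTransform (IsLocalRing.maximalIdeal R) (R ⧸ I ^ α) →ₗ[R]
            FormalLC.H 1 I α,
          (∀ (i j : ℕ) (h : i ≤ j),
            δ i ∘ₗ FormalLC.GlobalTransform.map (IsLocalRing.maximalIdeal R)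
              (FormalLC.proj I i j h) = FormalLC.transH 1 I i j h ∘ₗ δ j) ∧
          ∀ (y : FormalLC.limT I) (α : ℕ), (g y).1 α = δ α (y.1 α)) ∧
        Function.Injective f ∧ Function.Exact f g ∧ Function.Surjective g := by
  have := FormalLC.isNoetherianRing_adicCompletion I
  refine ⟨Submodule.IsLasker.exists_isMinimalPrimaryDecomposition (Submodule.isLasker _ _) ⊥, fun t ht =>
    ⟨FormalLC.quotientToLimT I ht, FormalLC.limConnecting I, FormalLC.quotientToLimT_mk I ht,
      ⟨FormalLC.connectingT I, fun i j h => LinearMap.ext (FormalLC.connectingT_map I i j h),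
        FormalLC.limConnecting_apply I⟩,
      FormalLC.quotientToLimT_injective I ht, fun y => ?_, FormalLC.limConnecting_surjective I⟩⟩
  rw [FormalLC.exact_completionToLimT_limConnecting I y]
  constructor
  · rintro ⟨x, rfl⟩
    exact ⟨Ideal.Quotient.mk _ x, rfl⟩
  · rintro ⟨x, rfl⟩
    obtain ⟨x, rfl⟩ := Ideal.Quotient.mk_surjective x
    exact ⟨x, rfl⟩
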